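/- A convex-polynomial is a polynomial $\sum_{k=0}^{d} a_k z^k$ with $a_k \ge 0$ for all $k$ and $\sum_{k=0}^{d} a_k = 1$, i.e. a convex combination of the monomials $1, z, z^2, \ldots$. Let $N, m, n \ge 0$ be integers, let $x_1,\dots,x_m \in \mathbb{R}$ and let $z_1,\dots,z_n \in \mathbb{C}\setminus\mathbb{R}$ (repetitions allowed). Then the following are equivalent: (a) for all real numbers $y_{j,k}$ ($0\le j\le N$, $1\le k\le m$) and all complex numbers $w_{j,k}$ ($0\le j\le N$, $1\le k\le n$) there exists a convex-polynomial $p$ such that $p^{(j)}(x_k) = y_{j,k}$ for all $0\le j\le N$ and $1\le k\le m$, and $p^{(j)}(z_k) = w_{j,k}$ for all $0\le j\le N$ and $1\le k\le n$; (b) the real numbers $x_1,\dots,x_m$ are distinct and satisfy $x_k < -1$ for all $1 \le k \le m$; the numbers $z_1,\dots,z_n$ are distinct, they all lie in $\mathbb{C}\setminus(\overline{\mathbb{D}}\cup\mathbb{R})$, where $\overline{\mathbb{D}}=\{z\in\mathbb{C} : |z|\le 1\}$, and $z_j \ne \overline{z_k}$ for all $1\le j,k\le n$. -/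

import Mathlib

/-- The set of convex-polynomials: the convex hull of the monomials `1, z, z², …` in the
vector space of all polynomials in one complex variable. -/
def convexPolynomials : Set (Polynomial ℂ) :=
  convexHull ℝ (Set.range fun k : ℕ => (Polynomial.X : Polynomial ℂ) ^ k)

open Polynomial

/-! ### Hermite interpolation -/

/-! Necessity: the coefficients of a convex-polynomial are nonnegative and sum to one, so it is
bounded by 1 on the closed disc, nonnegative on `[1, ∞)` and commutes with conjugation; each failure
of (b) makes some data impossible.

Sufficiency: let `F` be the product of the `(X - c) ^ (N + 1)` over all nodes `c`, and `h` a real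
Hermite interpolant. It suffices to find a convex-polynomial congruent to `h` modulo `F`. Since all
`|c| > 1`, `F` divides some `1 - e` with `e` as small as desired, so `h ≡ e * h` has a
representative with tiny coefficients. Since no `c` is a positive real, `F` divides some `P` with
nonnegative coefficients and constant term at least one. Adding multiples of `P` makes all
coefficients nonnegative and then brings their sum up to one
(`exists_mem_convexPolynomials_dvd_sub`).

Both divisibility properties are multiplicative, so linear factors suffice; one trinomial
(`X_sub_C_dvd_trinomial`) serves both, for different `n`. -/

/-- A polynomial with prescribed derivatives of order at most `N` at `c`. -/
theorem exists_iterate_derivative_eval_eq (N : ℕ) (c : ℂ) (w : ℕ → ℂ) :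
    ∃ q : ℂ[X], ∀ j ≤ N, (derivative^[j] q).eval c = w j := by
  refine ⟨∑ i ∈ Finset.range (N + 1), C (w i / (i.factorial : ℂ)) * (X - C c) ^ i, fun j hj => ?_⟩
  rw [iterate_derivative_sum, eval_finsetSum, Finset.sum_eq_single j]
  · have : (j.factorial : ℂ) ≠ 0 := by exact_mod_cast j.factorial_ne_zero
    rw [iterate_derivative_C_mul, iterate_derivative_X_sub_pow_self]
    simp [this]
  · intro i _ hij
    rw [iterate_derivative_C_mul, iterate_derivative_X_sub_pow]
    rcases lt_or_gt_of_ne hij with h | h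
    · simp [Nat.descFactorial_of_lt h]
    · simp [Nat.sub_ne_zero_of_lt h]
  · intro h
    exact absurd (Finset.mem_range.2 (Nat.lt_succ_of_le hj)) h

theorem eval_iterate_derivative_eq_zero_of_pow_dvd {N : ℕ} {c : ℂ} {p : ℂ[X]}
    (h : (X - C c) ^ (N + 1) ∣ p) {j : ℕ} (hj : j ≤ N) : (derivative^[j] p).eval c = 0 := by
  have h1 := pow_sub_dvd_iterate_derivative_of_pow_dvd j h
  have h2 : X - C c ∣ derivative^[j] p := (dvd_pow_self _ (by omega)).trans h1
  exact dvd_iff_isRoot.1 h2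

theorem eval_iterate_derivative_congr_of_pow_dvd {N : ℕ} {c : ℂ} {p q : ℂ[X]}
    (h : (X - C c) ^ (N + 1) ∣ p - q) {j : ℕ} (hj : j ≤ N) :
    (derivative^[j] p).eval c = (derivative^[j] q).eval c := by
  have := eval_iterate_derivative_eq_zero_of_pow_dvd h hj
  rwa [iterate_derivative_sub, eval_sub, sub_eq_zero] at this

/-- Hermite interpolation over `ℂ`. -/
theorem exists_hermite_interpolation {ι : Type*} [Finite ι] (N : ℕ) (c : ι → ℂ)
    (hc : Function.Injective c) (w : ℕ → ι → ℂ) :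
    ∃ q : ℂ[X], ∀ i, ∀ j ≤ N, (derivative^[j] q).eval (c i) = w j i := by
  choose t ht using fun i => exists_iterate_derivative_eval_eq N (c i) fun j => w j i
  have hI : Pairwise (Function.onFun IsCoprime
      fun i => Ideal.span {(X - C (c i)) ^ (N + 1)}) := fun i j hij =>
    (Ideal.isCoprime_span_singleton_iff _ _).2 (pairwise_coprime_X_sub_C hc hij).pow
  obtain ⟨q, hq⟩ := Ideal.exists_forall_sub_mem_ideal hI t
  refine ⟨q, fun i j hj => ?_⟩
  rw [← ht i j hj]
  exact eval_iterate_derivative_congr_of_pow_dvd (Ideal.mem_span_singleton.1 (hq i)) hj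

theorem eval_iterate_derivative_map_conj (p : ℂ[X]) (j : ℕ) (c : ℂ) :
    (derivative^[j] (p.map (starRingEnd ℂ))).eval c =
      starRingEnd ℂ ((derivative^[j] p).eval (starRingEnd ℂ c)) := by
  rw [iterate_derivative_map, ← eval_map_apply, Complex.conj_conj]

/-- Averaging a polynomial with its conjugate gives a polynomial with real coefficients. -/
theorem exists_map_ofReal_eq_average_conj (p : ℂ[X]) :
    ∃ q : ℝ[X], q.map Complex.ofRealHom = C (1 / 2) * (p + p.map (starRingEnd ℂ)) := by
  refine ⟨∑ k ∈ Finset.range (p.natDegree + 1), monomial k (p.coeff k).re, ?_⟩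
  ext k
  have hk : p.natDegree < k → p.coeff k = 0 := coeff_eq_zero_of_natDegree_lt
  simp only [coeff_map, finsetSum_coeff, coeff_monomial, Finset.sum_ite_eq', coeff_C_mul,
    coeff_add, Finset.mem_range, Nat.lt_succ_iff, Complex.add_conj]
  split_ifs with h
  · simp
  · simp [hk (not_le.1 h)]

/-- The conjugate nodes are added with conjugate data, so averaging the interpolant with its
conjugate leaves the prescribed values unchanged. -/
theorem exists_real_hermite_interpolation {ι κ : Type*} [Finite ι] [Finite κ] (N : ℕ)
    (x : ι → ℝ) (z : κ → ℂ) (hx : Function.Injective x) (hz : Function.Injective z)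
    (hzx : ∀ k, z k ∉ Set.range ((↑) : ℝ → ℂ)) (hzz : ∀ j k, z j ≠ starRingEnd ℂ (z k))
    (y : ℕ → ι → ℝ) (w : ℕ → κ → ℂ) :
    ∃ q : ℝ[X], (∀ k, ∀ j ≤ N,
        (derivative^[j] (q.map Complex.ofRealHom)).eval (x k : ℂ) = y j k) ∧
      ∀ k, ∀ j ≤ N, (derivative^[j] (q.map Complex.ofRealHom)).eval (z k) = w j k := by
  have hxz : ∀ i k, (x i : ℂ) ≠ z k := fun i k h => hzx k ⟨x i, h⟩
  have hxz' : ∀ i k, (x i : ℂ) ≠ starRingEnd ℂ (z k) := fun i k h =>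
    hxz i k (by rw [← Complex.conj_ofReal, h, Complex.conj_conj])
  have hinj : Function.Injective
      (Sum.elim (fun i => (x i : ℂ)) (Sum.elim z fun k => starRingEnd ℂ (z k))) := by
    refine Function.Injective.sumElim (Complex.ofReal_injective.comp hx)
      (hz.sumElim ((starRingEnd ℂ).injective.comp hz) hzz) ?_
    rintro i (k | k)
    exacts [hxz i k, hxz' i k]
  obtain ⟨p, hp⟩ := exists_hermite_interpolation N _ hinj fun j =>
    Sum.elim (fun i => (y j i : ℂ)) (Sum.elim (w j) fun k => starRingEnd ℂ (w j k))
  obtain ⟨q, hq⟩ := exists_map_ofReal_eq_average_conj p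
  have h1 := fun i => hp (Sum.inl i)
  have h2 := fun k => hp (Sum.inr (Sum.inl k))
  have h3 := fun k => hp (Sum.inr (Sum.inr k))
  simp only [Sum.elim_inl, Sum.elim_inr] at h1 h2 h3
  refine ⟨q, fun k j hj => ?_, fun k j hj => ?_⟩
  · rw [hq, iterate_derivative_C_mul, iterate_map_add, eval_C_mul, eval_add,
      eval_iterate_derivative_map_conj, Complex.conj_ofReal, h1 k j hj, Complex.conj_ofReal]
    ring
  · rw [hq, iterate_derivative_C_mul, iterate_map_add, eval_C_mul, eval_add,
      eval_iterate_derivative_map_conj, h2 k j hj, h3 k j hj, Complex.conj_conj]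
    ring

/-! ### Coefficientwise majorization -/

/-- The coefficients of `p` are bounded in absolute value by those of `r`. -/
def CoeffMajorized (p r : ℝ[X]) : Prop := ∀ k, |p.coeff k| ≤ r.coeff k

namespace CoeffMajorized

variable {p q r s : ℝ[X]}

theorem coeff_nonneg (h : CoeffMajorized p r) (k : ℕ) : 0 ≤ r.coeff k :=
  (abs_nonneg _).trans (h k)

theorem add (h : CoeffMajorized p r) (h' : CoeffMajorized q s) :
    CoeffMajorized (p + q) (r + s) := fun k => by
  rw [coeff_add, coeff_add]
  exact (abs_add_le _ _).trans (add_le_add (h k) (h' k))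

theorem neg (h : CoeffMajorized p r) : CoeffMajorized (-p) r := fun k => by
  rw [coeff_neg, abs_neg]
  exact h k

theorem mul (h : CoeffMajorized p r) (h' : CoeffMajorized q s) :
    CoeffMajorized (p * q) (r * s) := fun k => by
  rw [coeff_mul, coeff_mul]
  refine (Finset.abs_sum_le_sum_abs _ _).trans (Finset.sum_le_sum fun i _ => ?_)
  rw [abs_mul]
  exact mul_le_mul (h _) (h' _) (abs_nonneg _) (h.coeff_nonneg _)

theorem monomial (n : ℕ) (a : ℝ) :
    CoeffMajorized (Polynomial.monomial n a) (Polynomial.monomial n |a|) := fun k => by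
  rw [coeff_monomial, coeff_monomial]
  split_ifs <;> simp

theorem exists_majorant (p : ℝ[X]) : ∃ r, CoeffMajorized p r := by
  induction p using Polynomial.induction_on' with
  | add p q hp hq =>
    obtain ⟨r, hr⟩ := hp
    obtain ⟨s, hs⟩ := hq
    exact ⟨r + s, hr.add hs⟩
  | monomial n a => exact ⟨_, monomial n a⟩

end CoeffMajorized

theorem eval_one_nonneg_of_coeff_nonneg {p : ℝ[X]} (h : ∀ k, 0 ≤ p.coeff k) : 0 ≤ p.eval 1 := by
  rw [eval_eq_sum_range]
  exact Finset.sum_nonneg fun k _ => by simpa using h k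

theorem coeff_zero_le_eval_one {p : ℝ[X]} (h : ∀ k, 0 ≤ p.coeff k) : p.coeff 0 ≤ p.eval 1 := by
  rw [eval_eq_sum_range]
  simpa using Finset.single_le_sum (f := fun k => p.coeff k * 1 ^ k)
    (fun k _ => by simpa using h k) (Finset.mem_range.2 p.natDegree.succ_pos)

theorem coeff_mul_nonneg {p q : ℝ[X]} (hp : ∀ k, 0 ≤ p.coeff k) (hq : ∀ k, 0 ≤ q.coeff k)
    (k : ℕ) : 0 ≤ (p * q).coeff k := by
  rw [coeff_mul]
  exact Finset.sum_nonneg fun i _ => mul_nonneg (hp _) (hq _)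

/-- When `q` has constant term at least one, `p * q` therefore dominates `p` coefficientwise. -/
theorem coeff_mul_coeff_zero_le {p q : ℝ[X]} (hp : ∀ k, 0 ≤ p.coeff k)
    (hq : ∀ k, 0 ≤ q.coeff k) (k : ℕ) : p.coeff k * q.coeff 0 ≤ (p * q).coeff k := by
  rw [coeff_mul]
  exact Finset.single_le_sum (f := fun i : ℕ × ℕ => p.coeff i.1 * q.coeff i.2) (a := (k, 0))
    (fun i _ => mul_nonneg (hp _) (hq _)) (by simp)

/-! ### Divisors of positive polynomials and of small perturbations of one -/

/-- The polynomials dividing a real polynomial with nonnegative coefficients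
and constant term at least one. -/
def positiveDivisors : Submonoid ℂ[X] where
  carrier := {F | ∃ P : ℝ[X], (∀ k, 0 ≤ P.coeff k) ∧ 1 ≤ P.coeff 0 ∧ F ∣ P.map Complex.ofRealHom}
  one_mem' := ⟨1, fun k => by rw [coeff_one]; split_ifs <;> simp, by simp, one_dvd _⟩
  mul_mem' := by
    rintro F G ⟨P, hP, hP0, hF⟩ ⟨Q, hQ, hQ0, hG⟩
    refine ⟨P * Q, coeff_mul_nonneg hP hQ, ?_, ?_⟩
    · rw [mul_coeff_zero]
      exact one_le_mul_of_one_le_of_one_le hP0 hQ0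
    · rw [Polynomial.map_mul]
      exact mul_dvd_mul hF hG

/-- The polynomials dividing `1 - e` for real polynomials `e` of arbitrarily small `ℓ¹`-norm. -/
def nearOneDivisors : Submonoid ℂ[X] where
  carrier := {F | ∀ ε > 0, ∃ e r : ℝ[X], CoeffMajorized e r ∧ r.eval 1 ≤ ε ∧
    F ∣ (1 - e).map Complex.ofRealHom}
  one_mem' := fun ε hε => ⟨0, 0, fun k => by simp, by simpa using hε.le, one_dvd _⟩
  mul_mem' := by
    intro F G hF hG ε hε
    -- The bound 1 on `r.eval 1` makes the product term at most `s.eval 1`, leaving three terms of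
    -- size at most `ε / 3`.
    have hδ : 0 < min (ε / 3) 1 := by positivity
    obtain ⟨e, r, her, hr, hF⟩ := hF _ hδ
    obtain ⟨f, s, hfs, hs, hG⟩ := hG _ hδ
    refine ⟨e + f + -(e * f), r + s + r * s, (her.add hfs).add (her.mul hfs).neg, ?_, ?_⟩
    · have hs0 : 0 ≤ s.eval 1 := eval_one_nonneg_of_coeff_nonneg hfs.coeff_nonneg
      have hr1 := hr.trans (min_le_right _ _)
      have hr3 := hr.trans (min_le_left _ _)
      have hs3 := hs.trans (min_le_left _ _)
      have := mul_le_of_le_one_left hs0 hr1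
      rw [eval_add, eval_add, eval_mul]
      linarith
    · have : 1 - (e + f + -(e * f)) = (1 - e) * (1 - f) := by ring
      rw [this, Polynomial.map_mul]
      exact mul_dvd_mul hF hG

/-- With `u = c⁻¹ ^ n` the trinomial is `(1 - u X ^ n) (1 - ū X ^ n)`, whose first factor vanishes
at `c`. It is real, tends to 1 as `n` grows if `|c| > 1`, and has nonnegative coefficients if `Re u
≤ 0` and `n ≠ 0`. -/
theorem X_sub_C_dvd_trinomial {c : ℂ} (hc : c ≠ 0) (n : ℕ) :
    X - C c ∣ (1 - (monomial n (2 * (c⁻¹ ^ n).re) +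
      -monomial (2 * n) (‖c⁻¹ ^ n‖ ^ 2))).map Complex.ofRealHom := by
  rw [dvd_iff_isRoot, IsRoot.def]
  have h1 : c⁻¹ ^ n * c ^ n = 1 := by rw [← mul_pow, inv_mul_cancel₀ hc, one_pow]
  have h2 : ((2 * (c⁻¹ ^ n).re : ℝ) : ℂ) = c⁻¹ ^ n + starRingEnd ℂ (c⁻¹ ^ n) :=
    (Complex.add_conj _).symm
  have h3 : ((‖c⁻¹ ^ n‖ ^ 2 : ℝ) : ℂ) = c⁻¹ ^ n * starRingEnd ℂ (c⁻¹ ^ n) := by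
    rw [Complex.mul_conj, Complex.normSq_eq_norm_sq]
  simp only [Polynomial.map_sub, Polynomial.map_add, Polynomial.map_neg, Polynomial.map_one,
    map_monomial, eval_sub, eval_add, eval_neg, eval_one, eval_monomial, Complex.ofRealHom_eq_coe,
    h2, h3]
  rw [mul_comm 2 n, pow_mul]
  linear_combination (-1 + starRingEnd ℂ (c⁻¹ ^ n) * c ^ n) * h1

theorem X_sub_C_mem_nearOneDivisors {c : ℂ} (hc : 1 < ‖c‖) : X - C c ∈ nearOneDivisors := by
  have hc0 : c ≠ 0 := norm_pos_iff.1 (zero_lt_one.trans hc)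
  intro ε hε
  have hlim : Filter.Tendsto (fun n : ℕ => ‖c⁻¹‖ ^ n) Filter.atTop (nhds 0) :=
    tendsto_pow_atTop_nhds_zero_of_lt_one (norm_nonneg _) (by
      rw [norm_inv]; exact inv_lt_one_of_one_lt₀ hc)
  have hδ : 0 < min (ε / 3) 1 := by positivity
  obtain ⟨n, hn⟩ := (hlim.eventually (gt_mem_nhds hδ)).exists
  refine ⟨_, _, (CoeffMajorized.monomial _ _).add (CoeffMajorized.monomial _ _).neg, ?_,
    X_sub_C_dvd_trinomial hc0 n⟩
  have h1 := (hn.trans_le (min_le_right _ _)).le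
  have h3 := (hn.trans_le (min_le_left _ _)).le
  have hre : |(c⁻¹ ^ n).re| ≤ ‖c⁻¹‖ ^ n := by
    rw [← norm_pow]; exact Complex.abs_re_le_norm _
  have h0 : 0 ≤ ‖c⁻¹‖ ^ n := by positivity
  simp only [eval_add, eval_monomial, one_pow, mul_one, abs_mul, abs_two, abs_pow, abs_norm,
    norm_pow]
  nlinarith

/-- For nonreal `c`, the first multiple of `|arg c|` to reach `π / 2` cannot jump past `3π / 2`, as
the step is at most `π`. -/
theorem exists_pow_re_nonpos {c : ℂ} (hc : c ∉ Set.range ((↑) : ℝ → ℂ) ∨ c.re ≤ 0) :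
    ∃ n : ℕ, n ≠ 0 ∧ (c ^ n).re ≤ 0 := by
  rcases hc with hc | hc
  swap
  · exact ⟨1, one_ne_zero, by simpa using hc⟩
  have him : c.im ≠ 0 := fun h => hc ⟨c.re, Complex.ext rfl h.symm⟩
  have hθ : 0 < |c.arg| := abs_pos.2 fun h => him (Complex.arg_eq_zero_iff.1 h).2
  have hθ' : |c.arg| ≤ Real.pi := Complex.abs_arg_le_pi c
  have hpi := Real.pi_pos
  set θ := |c.arg| with hθdef
  set n := ⌈Real.pi / 2 / θ⌉₊ with hn
  have hpos : 0 < Real.pi / 2 / θ := by positivity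
  have hle : Real.pi / 2 ≤ n * θ := (div_le_iff₀ hθ).1 (Nat.le_ceil _)
  have hlt : n * θ < Real.pi / 2 + θ := by
    have := mul_lt_mul_of_pos_right (Nat.ceil_lt_add_one hpos.le) hθ
    rwa [add_mul, one_mul, div_mul_cancel₀ _ hθ.ne'] at this
  refine ⟨n, (Nat.ceil_pos.2 hpos).ne', ?_⟩
  have hcos : Real.cos (n * c.arg) ≤ 0 := by
    rw [← Real.cos_abs, abs_mul, Nat.abs_cast, ← hθdef]
    exact Real.cos_nonpos_of_pi_div_two_le_of_le hle (by linarith)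
  have hpow : c ^ n = ((‖c‖ ^ n : ℝ) : ℂ) * Complex.exp ((n * c.arg : ℝ) * Complex.I) := by
    conv_lhs => rw [← Complex.norm_mul_exp_arg_mul_I c, mul_pow, ← Complex.exp_nat_mul]
    push_cast
    ring_nf
  rw [hpow, Complex.re_ofReal_mul, Complex.exp_ofReal_mul_I_re]
  exact mul_nonpos_of_nonneg_of_nonpos (by positivity) hcos

theorem X_sub_C_mem_positiveDivisors {c : ℂ} (hc0 : c ≠ 0)
    (hc : c ∉ Set.range ((↑) : ℝ → ℂ) ∨ c.re ≤ 0) : X - C c ∈ positiveDivisors := by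
  have hc' : c⁻¹ ∉ Set.range ((↑) : ℝ → ℂ) ∨ c⁻¹.re ≤ 0 := by
    refine hc.imp ?_ ?_
    · rintro h ⟨x, hx⟩
      exact h ⟨x⁻¹, by rw [Complex.ofReal_inv, hx, inv_inv]⟩
    · intro h
      rw [Complex.inv_re]
      exact div_nonpos_of_nonpos_of_nonneg h (Complex.normSq_nonneg _)
  obtain ⟨n, hn, hre⟩ := exists_pow_re_nonpos hc'
  refine ⟨_, fun k => ?_, ?_, X_sub_C_dvd_trinomial hc0 n⟩
  · simp only [coeff_sub, coeff_add, coeff_neg, coeff_one, coeff_monomial]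
    have := sq_nonneg ‖c⁻¹ ^ n‖
    split_ifs <;> linarith
  · simp [coeff_monomial, hn]

/-! ### Convex-polynomials -/

theorem map_ofReal_mem_convexPolynomials {q : ℝ[X]} (hq : ∀ k, 0 ≤ q.coeff k)
    (h1 : q.eval 1 = 1) : q.map Complex.ofRealHom ∈ convexPolynomials := by
  rw [eval_eq_sum_range] at h1
  simp only [one_pow, mul_one] at h1
  have hsum : q.map Complex.ofRealHom =
      ∑ k ∈ Finset.range (q.natDegree + 1), q.coeff k • (X : ℂ[X]) ^ k := by
    conv_lhs => rw [q.as_sum_range]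
    rw [Polynomial.map_sum]
    refine Finset.sum_congr rfl fun k _ => ?_
    ext i
    simp [coeff_monomial, coeff_X_pow, eq_comm]
  rw [hsum]
  exact (convex_convexHull ℝ _).sum_mem (fun k _ => hq k) h1
    fun k _ => subset_convexHull ℝ _ ⟨k, rfl⟩

theorem exists_of_mem_convexPolynomials {p : ℂ[X]} (hp : p ∈ convexPolynomials) :
    ∃ q : ℝ[X], (∀ k, 0 ≤ q.coeff k) ∧ q.eval 1 = 1 ∧ q.map Complex.ofRealHom = p := by
  have hconv : Convex ℝ {p : ℂ[X] | ∃ q : ℝ[X], (∀ k, 0 ≤ q.coeff k) ∧ q.eval 1 = 1 ∧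
      q.map Complex.ofRealHom = p} := by
    rintro _ ⟨q, hq, hq1, rfl⟩ _ ⟨r, hr, hr1, rfl⟩ a b ha hb hab
    refine ⟨a • q + b • r, fun k => ?_, ?_, ?_⟩
    · simp only [coeff_add, coeff_smul, smul_eq_mul]
      exact add_nonneg (mul_nonneg ha (hq k)) (mul_nonneg hb (hr k))
    · simp [eval_smul, hq1, hr1, hab]
    · ext i
      simp
  refine convexHull_min ?_ hconv hp
  rintro _ ⟨k, rfl⟩
  refine ⟨X ^ k, fun i => ?_, by simp, by simp⟩
  rw [coeff_X_pow]
  split_ifs <;> simp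

theorem norm_eval_le_one_of_mem_convexPolynomials {p : ℂ[X]} (hp : p ∈ convexPolynomials) {c : ℂ}
    (hc : ‖c‖ ≤ 1) : ‖p.eval c‖ ≤ 1 := by
  obtain ⟨q, hq, hq1, rfl⟩ := exists_of_mem_convexPolynomials hp
  rw [← hq1, eval_map, eval₂_eq_sum_range, eval_eq_sum_range]
  refine norm_sum_le_of_le _ fun k _ => ?_
  rw [norm_mul, norm_pow, Complex.ofRealHom_eq_coe, Complex.norm_real, Real.norm_of_nonneg (hq k),
    one_pow]
  exact mul_le_mul_of_nonneg_left (pow_le_one₀ (norm_nonneg _) hc) (hq k)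

theorem neg_one_le_re_eval_of_mem_convexPolynomials {p : ℂ[X]} (hp : p ∈ convexPolynomials)
    {x : ℝ} (hx : -1 ≤ x) : -1 ≤ (p.eval (x : ℂ)).re := by
  rcases le_total x 1 with h | h
  · refine (abs_le.1 ((Complex.abs_re_le_norm _).trans
      (norm_eval_le_one_of_mem_convexPolynomials hp ?_))).1
    rw [Complex.norm_real]
    exact abs_le.2 ⟨hx, h⟩
  · obtain ⟨q, hq, -, rfl⟩ := exists_of_mem_convexPolynomials hp
    have : (q.map Complex.ofRealHom).eval (x : ℂ) = ((q.eval x : ℝ) : ℂ) :=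
      eval_map_apply Complex.ofRealHom x
    rw [this, Complex.ofReal_re, eval_eq_sum_range]
    have : 0 ≤ ∑ k ∈ Finset.range (q.natDegree + 1), q.coeff k * x ^ k :=
      Finset.sum_nonneg fun k _ => mul_nonneg (hq k) (pow_nonneg (by linarith) k)
    linarith

theorem eval_conj_of_mem_convexPolynomials {p : ℂ[X]} (hp : p ∈ convexPolynomials) (c : ℂ) :
    p.eval (starRingEnd ℂ c) = starRingEnd ℂ (p.eval c) := by
  obtain ⟨q, -, -, rfl⟩ := exists_of_mem_convexPolynomials hp
  have h : (q.map Complex.ofRealHom).map (starRingEnd ℂ) = q.map Complex.ofRealHom := by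
    ext i
    simp
  conv_lhs => rw [← h]
  exact eval_map_apply (starRingEnd ℂ) c

/-- Every real polynomial is congruent to a convex-polynomial modulo a polynomial which divides
both a positive polynomial and arbitrarily small perturbations of one. -/
theorem exists_mem_convexPolynomials_dvd_sub {F : ℂ[X]} (hF : F ∈ positiveDivisors)
    (hF' : F ∈ nearOneDivisors) (h : ℝ[X]) :
    ∃ p ∈ convexPolynomials, F ∣ p - h.map Complex.ofRealHom := by
  obtain ⟨P, hP, hP0, hFP⟩ := hF
  obtain ⟨s, hs⟩ := CoeffMajorized.exists_majorant h
  have hP1 : 1 ≤ P.eval 1 := hP0.trans (coeff_zero_le_eval_one hP)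
  have hs1 : 0 ≤ s.eval 1 := eval_one_nonneg_of_coeff_nonneg hs.coeff_nonneg
  -- This size leaves room for the correction `r * s * P` within total mass one; the `+ 1` avoids
  -- dividing by zero when `s.eval 1 = 0`.
  obtain ⟨e, r, her, hr, hFe⟩ := hF' (1 / ((s.eval 1 + 1) * (1 + P.eval 1))) (by positivity)
  have hm := her.mul hs
  have ht := hm.coeff_nonneg
  have hbound : (r * s).eval 1 * (1 + P.eval 1) ≤ 1 := by
    have hr0 : 0 ≤ r.eval 1 := eval_one_nonneg_of_coeff_nonneg her.coeff_nonneg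
    rw [le_div_iff₀ (by positivity)] at hr
    rw [eval_mul]
    nlinarith [mul_nonneg hr0 (by positivity : 0 ≤ 1 + P.eval 1)]
  have hle : (e * h).eval 1 ≤ (r * s).eval 1 := by
    have : 0 ≤ (r * s - e * h).eval 1 := eval_one_nonneg_of_coeff_nonneg fun k => by
      rw [coeff_sub]
      linarith [le_abs_self ((e * h).coeff k), hm k]
    rw [eval_sub] at this
    linarith
  -- The term `r * s * P` outweighs the negative coefficients of `e * h`; `a` is the multiple of `P`
  -- that supplies the mass still missing at 1.
  set a : ℝ := (1 - (e * h + r * s * P).eval 1) / P.eval 1 with ha_def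
  have ha : 0 ≤ a := by
    refine div_nonneg ?_ (by linarith)
    rw [eval_add, eval_mul (p := r * s)]
    linarith
  refine ⟨(e * h + r * s * P + C a * P).map Complex.ofRealHom,
    map_ofReal_mem_convexPolynomials (fun k => ?_) ?_, ?_⟩
  · rw [coeff_add, coeff_add, coeff_C_mul]
    have h1 := coeff_mul_coeff_zero_le ht hP k
    have h2 := le_mul_of_one_le_right (ht k) hP0
    have h3 := mul_nonneg ha (hP k)
    linarith [neg_abs_le ((e * h).coeff k), hm k]
  · rw [eval_add, eval_C_mul, ha_def, div_mul_cancel₀ _ (by linarith)]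
    ring
  · have : (e * h + r * s * P + C a * P).map Complex.ofRealHom - h.map Complex.ofRealHom =
        P.map Complex.ofRealHom * (r * s + C a).map Complex.ofRealHom -
          (1 - e).map Complex.ofRealHom * h.map Complex.ofRealHom := by
      simp only [← Polynomial.map_mul, ← Polynomial.map_sub]
      congr 1
      ring
    rw [this]
    exact (hFP.mul_right _).sub (hFe.mul_right _)

theorem theoremT (N m n : ℕ) (x : Fin m → ℝ) (z : Fin n → ℂ)
    (hz : ∀ k, z k ∉ Set.range ((↑) : ℝ → ℂ)) :
    (∀ (y : Fin (N + 1) → Fin m → ℝ) (w : Fin (N + 1) → Fin n → ℂ),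
      ∃ p ∈ convexPolynomials,
        (∀ (j : Fin (N + 1)) (k : Fin m),
          (Polynomial.derivative^[(j : ℕ)] p).eval (x k : ℂ) = (y j k : ℂ)) ∧
        (∀ (j : Fin (N + 1)) (k : Fin n),
          (Polynomial.derivative^[(j : ℕ)] p).eval (z k) = w j k)) ↔
    (Function.Injective x ∧ (∀ k, x k ∈ Set.Iio (-1 : ℝ)) ∧
      Function.Injective z ∧
      (∀ k, z k ∉ Metric.closedBall (0 : ℂ) 1 ∪ Set.range ((↑) : ℝ → ℂ)) ∧
      (∀ j k, z j ≠ (starRingEnd ℂ) (z k))) := by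
  constructor
  · intro H
    have H0 : ∀ (y : Fin m → ℝ) (w : Fin n → ℂ), ∃ p ∈ convexPolynomials,
        (∀ k, p.eval (x k : ℂ) = y k) ∧ ∀ k, p.eval (z k) = w k := fun y w => by
      -- Only the conditions with `j = 0` are needed, so the data may be taken constant in `j`.
      obtain ⟨p, hp, hx, hz⟩ := H (fun _ => y) fun _ => w
      exact ⟨p, hp, hx 0, hz 0⟩
    refine ⟨fun i j hij => ?_, fun k => ?_, fun i j hij => ?_, fun k => ?_, fun i j hij => ?_⟩
    · obtain ⟨p, -, hp, -⟩ := H0 (fun k => if k = i then 1 else 0) 0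
      by_contra hne
      have hi := hp i
      rw [hij, hp j, if_pos rfl, if_neg (Ne.symm hne)] at hi
      simp at hi
    · obtain ⟨p, hpc, hp, -⟩ := H0 (fun _ => -2) 0
      by_contra hk
      have := neg_one_le_re_eval_of_mem_convexPolynomials hpc (not_lt.1 hk)
      rw [hp k, Complex.ofReal_re] at this
      norm_num at this
    · obtain ⟨p, -, -, hp⟩ := H0 0 fun k => if k = i then 1 else 0
      by_contra hne
      have hi := hp i
      rw [hij, hp j, if_pos rfl, if_neg (Ne.symm hne)] at hi
      simp at hi
    · rintro (hk | hk)
      · obtain ⟨p, hpc, -, hp⟩ := H0 0 fun _ => 2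
        have := norm_eval_le_one_of_mem_convexPolynomials hpc (mem_closedBall_zero_iff.1 hk)
        rw [hp k] at this
        norm_num at this
      · exact hz k hk
    · obtain rfl | hne := eq_or_ne i j
      · exact hz i (Complex.conj_eq_iff_real.1 hij.symm |>.imp fun _ h => h.symm)
      · obtain ⟨p, hpc, -, hp⟩ := H0 0 fun k => if k = i then 1 else 0
        have hi := eval_conj_of_mem_convexPolynomials hpc (z j)
        rw [← hij, hp i, hp j, if_pos rfl, if_neg (Ne.symm hne)] at hi
        simp at hi
  · rintro ⟨hx, hx1, hzinj, hz1, hzz⟩ y w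
    -- `Fin.ofNat` reduces modulo `N + 1`, which changes nothing for `j ≤ N`.
    obtain ⟨h, hhx, hhz⟩ := exists_real_hermite_interpolation N x z hx hzinj hz hzz
      (fun j => y (Fin.ofNat (N + 1) j)) (fun j => w (Fin.ofNat (N + 1) j))
    let c : Fin m ⊕ Fin n → ℂ := Sum.elim (fun k => (x k : ℂ)) z
    have hc1 : ∀ i, 1 < ‖c i‖ := by
      rintro (k | k)
      · change 1 < ‖(x k : ℂ)‖
        rw [Complex.norm_real]
        exact lt_abs.2 (Or.inr (by linarith [Set.mem_Iio.1 (hx1 k)]))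
      · exact not_le.1 fun hk => hz1 k (Or.inl (mem_closedBall_zero_iff.2 hk))
    have hc : ∀ i, c i ∉ Set.range ((↑) : ℝ → ℂ) ∨ (c i).re ≤ 0 := by
      rintro (k | k)
      · exact Or.inr (by
          change (x k : ℂ).re ≤ 0
          rw [Complex.ofReal_re]
          linarith [Set.mem_Iio.1 (hx1 k)])
      · exact Or.inl (hz k)
    obtain ⟨p, hp, hdvd⟩ := exists_mem_convexPolynomials_dvd_sub
      (F := ∏ i, (X - C (c i)) ^ (N + 1))
      (Submonoid.prod_mem _ fun i _ => Submonoid.pow_mem _ (X_sub_C_mem_positiveDivisors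
        (norm_pos_iff.1 (zero_lt_one.trans (hc1 i))) (hc i)) _)
      (Submonoid.prod_mem _ fun i _ =>
        Submonoid.pow_mem _ (X_sub_C_mem_nearOneDivisors (hc1 i)) _) h
    have key : ∀ i, ∀ j : Fin (N + 1), (derivative^[(j : ℕ)] p).eval (c i) =
        (derivative^[(j : ℕ)] (h.map Complex.ofRealHom)).eval (c i) := fun i j =>
      eval_iterate_derivative_congr_of_pow_dvd
        ((Finset.dvd_prod_of_mem (fun i => (X - C (c i)) ^ (N + 1))
          (Finset.mem_univ i)).trans hdvd) (Nat.le_of_lt_succ j.2)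
    refine ⟨p, hp, fun j k => ?_, fun j k => ?_⟩
    · refine (key (Sum.inl k) j).trans ?_
      simpa [c] using hhx k j (Nat.le_of_lt_succ j.2)
    · refine (key (Sum.inr k) j).trans ?_
      simpa [c] using hhz k j (Nat.le_of_lt_succ j.2)
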